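/- Fix an integer $b\ge 2$. A base $b$ over-expansion of a positive integer $N$ is a word $d_t d_{t-1}\cdots d_0$ over $\{0,1,\dots,b\}$ with $d_t\neq 0$ and $\sum_{i=0}^t d_i b^i=N$. Let $s_b(0)=0$, $s_b(1)=1$, and for $n\ge 2$ let $s_b(n)$ be the number of base $b$ over-expansions of $n-1$. For nonnegative integers $k,r,y$ with $2y<r<k-1$ put \[I(k,r,y)=\Bigl\{n\in\mathbb N: b^k<n\le b^k+\sum_{i=0}^{y}b^{r-2i}\Bigr\},\] \[\mu(k,r,y)=\max\{s_b(n):n\in I(k,r,y)\},\qquad \nu(k,r,y)=\min\{n\in I(k,r,y): s_b(n)=\mu(k,r,y)\}.\] For nonnegative integers $k,r,x$ with $2x<r<k-1$, let $\gamma(k,r,x)$ be the positive integer whose ordinary base $b$ expansion is the word $1\,0^{k-r-1}(10)^x\,0\,(10)^{\lfloor r/2\rfloor-x}$ if $r$ is even, and $1\,0^{k-r-1}(10)^x\,0\,(10)^{\lfloor r/2\rfloor-x}\,0$ if $r$ is odd (exponents denote repetition of words). For integers $k,r,x$, let \[V(k,r,x)=\tfrac15\bigl((k-r)(2L_{r+2}-L_{r-4x+1})+2L_{r+1}+L_{r-4x+2}\bigr),\]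 where $(L_m)_{m\in\mathbb Z}$ are the Lucas numbers: $L_1=1$, $L_2=3$, $L_{m+2}=L_{m+1}+L_m$ for all $m\in\mathbb Z$. **Theorem.** Let $k,r,y$ be nonnegative integers such that $2y<r<k-1$. (a) If $r$ is even, then $\nu(k,r,y)=\gamma(k,r,y)+1$ and $\mu(k,r,y)=V(k,r,y)$. (b) If $k-2=r\equiv 3\pmod 4$ and $y\ge\frac{r+1}{4}$, then $\nu(k,r,y)=\gamma\bigl(k,r,\frac{r-3}{4}\bigr)+1$ and $\mu(k,r,y)=V\bigl(k,r,\frac{r-3}{4}\bigr)$. (c) Otherwise, $\nu(k,r,y)=\gamma(k,r,\delta(r,y))+1$ and $\mu(k,r,y)=V(k,r,\delta(r,y))$, where $\delta(r,y)=\min\bigl\{\bigl\lceil\frac{r-1}{4}\bigr\rceil,y\bigr\}$. -/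

import Mathlib

/-- `w` is a base `b` over-expansion of `N`: a nonempty word over the alphabet `{0, …, b}`, most
significant digit first, whose leading letter is nonzero and whose base `b` value is `N`. -/
def IsOverExpansion (b N : ℕ) (w : List ℕ) : Prop :=
  (∃ d u, w = d :: u ∧ d ≠ 0) ∧ (∀ d ∈ w, d ≤ b) ∧ Nat.ofDigits b w.reverse = N

/-- `s_b(n)`: the number of base `b` over-expansions of `n - 1` for `n ≥ 2`, with the conventions
`s_b(0) = 0` and `s_b(1) = 1`. -/
noncomputable def sternB (b : ℕ) : ℕ → ℕ
  | 0 => 0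
  | 1 => 1
  | n + 2 => {w : List ℕ | IsOverExpansion b (n + 1) w}.ncard

/-- There are only finitely many over-expansions, so `Set.ncard` above is a true count. -/
theorem finite_isOverExpansion (b N : ℕ) (hb : 2 ≤ b) :
    {w : List ℕ | IsOverExpansion b N w}.Finite := by
  have key : ∀ w : List ℕ, IsOverExpansion b N w → w.length ≤ N := by
    rintro w ⟨⟨d, u, rfl, hd⟩, -, hN⟩
    rw [List.reverse_cons, Nat.ofDigits_append, Nat.ofDigits_singleton, List.length_reverse] at hN
    have h1 : u.length < b ^ u.length := Nat.lt_pow_self (by omega)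
    have h2 : b ^ u.length ≤ b ^ u.length * d := Nat.le_mul_of_pos_right _ (by omega)
    simp only [List.length_cons]
    omega
  refine ((List.finite_length_le (Fin (b + 1)) N).image (List.map Fin.val)).subset ?_
  intro w hw
  refine ⟨w.map (fun d => Fin.ofNat (b + 1) d), ?_, ?_⟩
  · simpa using key w hw
  · rw [List.map_map]
    conv_rhs => rw [← List.map_id w]
    refine List.map_congr_left fun d hd => ?_
    have := hw.2.1 d hd
    simp only [Function.comp_apply, Fin.val_ofNat, id]
    exact Nat.mod_eq_of_lt (by omega)

/-- `I(k, r, y) = {n : b ^ k < n ≤ b ^ k + ∑_{i=0}^{y} b ^ (r - 2 i)}`, used for `2 y < r` only, so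
that the natural number subtraction is exact. -/
def sternI (b k r y : ℕ) : Set ℕ :=
  {n | b ^ k < n ∧ n ≤ b ^ k + ∑ i ∈ Finset.range (y + 1), b ^ (r - 2 * i)}

/-- `μ(k, r, y)`: the maximum of `s_b` on `I(k, r, y)`. -/
noncomputable def sternMu (b k r y : ℕ) : ℕ :=
  sSup (sternB b '' sternI b k r y)

/-- `ν(k, r, y)`: the least element of `I(k, r, y)` at which `s_b` equals `μ(k, r, y)`. -/
noncomputable def sternNu (b k r y : ℕ) : ℕ :=
  sInf {n | n ∈ sternI b k r y ∧ sternB b n = sternMu b k r y}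

/-- The supremum defining `μ` is an attained maximum. -/
theorem sternMu_isGreatest (b k r y : ℕ) (hb : 2 ≤ b) :
    IsGreatest (sternB b '' sternI b k r y) (sternMu b k r y) := by
  have hne : (sternB b '' sternI b k r y).Nonempty := by
    refine Set.Nonempty.image _ ⟨b ^ k + 1, Nat.lt_succ_self _, Nat.add_le_add_left ?_ _⟩
    exact (Nat.one_le_pow (r - 2 * 0) b (by omega)).trans
      (Finset.single_le_sum (f := fun i => b ^ (r - 2 * i)) (fun _ _ => Nat.zero_le _)
        (Finset.mem_range.2 (Nat.succ_pos y)))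
  have hbd : BddAbove (sternB b '' sternI b k r y) :=
    (((Set.finite_Iic _).subset fun _ hn => hn.2).image _).bddAbove
  exact ⟨Nat.sSup_mem hne hbd, fun _ hx => le_csSup hbd hx⟩

/-- The infimum defining `ν` is an attained minimum. -/
theorem sternNu_isLeast (b k r y : ℕ) (hb : 2 ≤ b) :
    IsLeast {n | n ∈ sternI b k r y ∧ sternB b n = sternMu b k r y} (sternNu b k r y) :=
  ⟨Nat.sInf_mem (sternMu_isGreatest b k r y hb).1, fun _ hx => Nat.sInf_le hx⟩

/-- The word `w(k, r, x) = 1 0^{k-r-1} (10)^x 0 (10)^{⌊r/2⌋-x}`, followed by one more `0` if `r` is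
odd, most significant digit first; used for `2 x < r < k - 1` only. -/
def gammaWord (k r x : ℕ) : List ℕ :=
  [1] ++ List.replicate (k - r - 1) 0 ++ (List.replicate x [1, 0]).flatten ++ [0] ++
    (List.replicate (r / 2 - x) [1, 0]).flatten ++ (if Odd r then [0] else [])

/-- `γ(k, r, x)`: the number with ordinary base `b` expansion `w(k, r, x)`. -/
def sternGamma (b k r x : ℕ) : ℕ :=
  Nat.ofDigits b (gammaWord k r x).reverse

/-- The Lucas numbers `L_m`, for all integers `m`. -/
def lucasZ (m : ℤ) : ℤ := Int.fib (m - 1) + Int.fib (m + 1)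

/-- The initial values `L_1 = 1`, `L_2 = 3` and the recurrence, which determine `L`. -/
theorem lucasZ_spec :
    lucasZ 1 = 1 ∧ lucasZ 2 = 3 ∧ ∀ m : ℤ, lucasZ (m + 2) = lucasZ (m + 1) + lucasZ m := by
  refine ⟨by decide, by decide, fun m => ?_⟩
  have h1 := Int.fib_add_two (n := m - 1)
  have h2 := Int.fib_add_two (n := m + 1)
  unfold lucasZ
  ring_nf at h1 h2 ⊢
  linarith

/-- `V(k, r, x) = (1/5) ((k - r) (2 L_{r+2} - L_{r-4x+1}) + 2 L_{r+1} + L_{r-4x+2})`. -/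
def lucasV (k r x : ℤ) : ℚ :=
  1 / 5 * (((k : ℚ) - r) * (2 * lucasZ (r + 2) - lucasZ (r - 4 * x + 1)) +
    2 * lucasZ (r + 1) + lucasZ (r - 4 * x + 2))

/-- `δ(r, y) = min {⌈(r - 1) / 4⌉, y}`. -/
def sternDelta (r y : ℕ) : ℕ :=
  min ⌈((r : ℚ) - 1) / 4⌉₊ y

/-!
Write a pair `(s_b(M + 1), s_b(M))` as `(p, q)`. The last digit of an over-expansion of `N` is
`N mod b` if `b ∤ N`, and `0` or `b` if `b ∣ N`; hence appending an ordinary base `b` digit `d` to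
`M` turns `(p, q)` into `(p + q, q)` if `d = 0`, into `(p, p + q)` if `d = 1` and into `(p, p)` if
`d ≥ 2` (`sternB_mul_add_one`, `sternB_mul`, `sternB_mul_add`). Therefore appending a block of `L`
digits makes the new first coordinate `α p + β q`, with `α` and `β` depending on the block only, and
induction on `L` gives `α, β ≤ F_{L+1}` and `α + β ≤ F_{L+2}` (`exists_tail_coeff`). For `p > q > 0`
it follows that `α p + β q = α (p - q) + (α + β) q` is at most `F_{L+1} p + F_L q`, with equality
for the block `1010⋯` alone (ending in `00` if `L ≥ 3` is odd).

The numbers `n` in `I(k, r, y)` are sorted by the first place at which `n - 1` falls below the upper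
end of the interval: the base `b` word of `n - 1` is `1 0^{k-r-1} (10)^x 0` followed by `r - 2 x`
arbitrary digits, for exactly one `x ≤ y` (`exists_class_of_mem_sternI`). By the bound above the
maximum of `s_b` on the class of `x` is attained at `γ(k, r, x) + 1` only; it is an expression in
Fibonacci numbers equal to `V(k, r, x)` (`classMax_eq_lucasV`).

It remains to find the first `x ≤ y` that maximizes `V(k, r, x)`. With `t = r - 4 x`,
`V(k, r, x + 1) - V(k, r, x) = (k - r) F_{t-1} - F_t = (k - r - 2) F_{t-1} + F_{t-3}`. If `r` is
even, both indices in the last expression are odd, and it is positive. If `r` is odd, it is positive for `t ≥ 3` and negative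
for `t ≤ 1`, except that it vanishes for `t = 3`, `k = r + 2`; this tie is what makes the case
`k = r + 2`, `r ≡ 3 (mod 4)` special.
-/

/-! ### The recurrence for `s_b` -/

/-- The little-endian over-expansions of `N`: digit lists over `{0, …, b}` of value `N`, whose last
(most significant) digit, if there is one, is nonzero. The empty list is admitted, as an expansion
of `0`; this matches the convention `s_b(1) = 1`. -/
def overDigits (b N : ℕ) : Set (List ℕ) :=
  {l | (∀ d ∈ l, d ≤ b) ∧ l.getLast? ≠ some 0 ∧ Nat.ofDigits b l = N}

theorem overDigits_eq_preimage (b N : ℕ) :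
    overDigits b (N + 1) = List.reverse ⁻¹' {w | IsOverExpansion b (N + 1) w} := by
  ext l
  simp only [overDigits, IsOverExpansion, Set.mem_ofPred_eq, Set.mem_preimage, List.reverse_reverse,
    List.mem_reverse]
  rcases List.eq_nil_or_concat l with rfl | ⟨u, d, rfl⟩
  · simp
  · simp only [List.concat_eq_append, List.getLast?_append, List.reverse_append]
    simp
    tauto

theorem sternB_succ (b N : ℕ) (hb : 2 ≤ b) : sternB b (N + 1) = (overDigits b N).ncard := by
  cases N with
  | zero =>
    have h : overDigits b 0 = {[]} := by
      ext l
      simp only [overDigits, Set.mem_ofPred_eq, Set.mem_singleton_iff]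
      constructor
      · rintro ⟨-, h1, h2⟩
        rcases List.eq_nil_or_concat l with rfl | ⟨u, d, rfl⟩
        · rfl
        · rw [List.concat_eq_append, Nat.ofDigits_append, Nat.ofDigits_singleton] at h2
          simp at h1
          have : b ^ u.length * d = 0 := by omega
          simp at this
          omega
      · rintro rfl
        simp
    rw [h, Set.ncard_singleton]
    rfl
  | succ N =>
    rw [overDigits_eq_preimage, Set.ncard_preimage_of_injective_subset_range
      List.reverse_injective]
    · rfl
    · exact fun w _ => ⟨w.reverse, List.reverse_reverse w⟩

theorem overDigits_finite (b N : ℕ) (hb : 2 ≤ b) : (overDigits b N).Finite := by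
  cases N with
  | zero =>
    refine Set.finite_of_ncard_ne_zero ?_
    rw [← sternB_succ b 0 hb]
    exact one_ne_zero
  | succ N =>
    rw [overDigits_eq_preimage]
    exact (finite_isOverExpansion b (N + 1) hb).preimage List.reverse_injective.injOn

theorem cons_mem_overDigits {b N d : ℕ} {l : List ℕ} :
    d :: l ∈ overDigits b N ↔
      d ≤ b ∧ (l = [] → d ≠ 0) ∧ ∃ M, l ∈ overDigits b M ∧ d + b * M = N := by
  simp only [overDigits, Set.mem_ofPred_eq, List.mem_cons, forall_eq_or_imp, Nat.ofDigits_cons,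
    List.getLast?_cons]
  cases l using List.reverseRecOn with
  | nil => simp
  | append_singleton u a => simp; tauto

theorem overDigits_of_digit (b M d : ℕ) (hd : d ≠ 0) (hdb : d < b) :
    overDigits b (b * M + d) = List.cons d '' overDigits b M := by
  ext l
  cases l with
  | nil => simp [overDigits]; omega
  | cons c l =>
    simp only [cons_mem_overDigits, Set.mem_image, List.cons.injEq]
    constructor
    · rintro ⟨h1, -, K, hK, h⟩
      have hc : c = d := by
        have h2 : (c + b * K) % b = (b * M + d) % b := by rw [h]
        rw [Nat.add_mul_mod_self_left, Nat.mul_add_mod, Nat.mod_eq_of_lt hdb] at h2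
        rcases h1.lt_or_eq with h3 | rfl
        · rwa [Nat.mod_eq_of_lt h3] at h2
        · rw [Nat.mod_self] at h2
          exact absurd h2.symm hd
      subst hc
      have : K = M := Nat.eq_of_mul_eq_mul_left (by omega : 0 < b) (by omega)
      exact ⟨l, this ▸ hK, rfl, rfl⟩
    · rintro ⟨l', h, rfl, rfl⟩
      exact ⟨hdb.le, fun _ => hd, M, h, by ring⟩

theorem overDigits_mul (b M : ℕ) (hb : 2 ≤ b) :
    overDigits b (b * (M + 1)) =
      List.cons 0 '' overDigits b (M + 1) ∪ List.cons b '' overDigits b M := by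
  ext l
  cases l with
  | nil => simp [overDigits]; omega
  | cons c l =>
    simp only [cons_mem_overDigits, Set.mem_union, Set.mem_image, List.cons.injEq]
    constructor
    · rintro ⟨h1, -, K, hK, h⟩
      have h2 : b ∣ c := (Nat.dvd_add_left (dvd_mul_right b K)).1 (h ▸ dvd_mul_right b (M + 1))
      obtain ⟨j, rfl⟩ := h2
      have h4 : j + K = M + 1 :=
        Nat.eq_of_mul_eq_mul_left (by omega : 0 < b) (by rw [mul_add]; exact h)
      have h3 : j ≤ 1 := Nat.le_of_mul_le_mul_left (by rwa [mul_one]) (by omega : 0 < b)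
      interval_cases j
      · exact Or.inl ⟨l, by rwa [← h4, zero_add], by simp⟩
      · obtain rfl : K = M := by omega
        exact Or.inr ⟨l, hK, by simp⟩
    · rintro (⟨l', h, rfl, rfl⟩ | ⟨l', h, rfl, rfl⟩)
      · refine ⟨Nat.zero_le _, ?_, M + 1, h, by ring⟩
        rintro rfl
        simp [overDigits] at h
      · exact ⟨le_rfl, fun _ => by omega, M, h, by ring⟩

theorem sternB_mul_add (b M j : ℕ) (hb : 2 ≤ b) (hj : 2 ≤ j) (hjb : j ≤ b) :
    sternB b (b * M + j) = sternB b (M + 1) := by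
  obtain ⟨d, rfl⟩ : ∃ d, j = d + 1 := ⟨j - 1, by omega⟩
  rw [← add_assoc, sternB_succ _ _ hb, sternB_succ _ _ hb,
    overDigits_of_digit b M d (by omega) (by omega),
    Set.ncard_image_of_injective _ List.cons_injective]

theorem sternB_mul_add_one (b M : ℕ) (hb : 2 ≤ b) :
    sternB b (b * M + 1) = sternB b (M + 1) + sternB b M := by
  cases M with
  | zero => rfl
  | succ M =>
    have hdisj : Disjoint (List.cons 0 '' overDigits b (M + 1)) (List.cons b '' overDigits b M) := by
      rw [Set.disjoint_left]
      rintro _ ⟨l, -, rfl⟩ ⟨l', -, h⟩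
      rw [List.cons.injEq] at h
      omega
    rw [sternB_succ _ _ hb, sternB_succ _ _ hb, sternB_succ _ _ hb, overDigits_mul b M hb,
      Set.ncard_union_eq hdisj ((overDigits_finite _ _ hb).image _)
        ((overDigits_finite _ _ hb).image _),
      Set.ncard_image_of_injective _ List.cons_injective,
      Set.ncard_image_of_injective _ List.cons_injective]

theorem sternB_mul (b M : ℕ) (hb : 2 ≤ b) : sternB b (b * M) = sternB b M := by
  cases M with
  | zero => rfl
  | succ M => rw [mul_add, mul_one, sternB_mul_add b M b hb hb le_rfl]

/-! ### The best tail of a given length -/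

/-- The value of the word of length `L` read off from the left of `101010⋯`, with its last letter
replaced by `0` if `L` is odd: `(10)^{L/2}` for even `L`, and `(10)^{⌊L/2⌋} 0` for odd `L`. -/
def bestTail (b : ℕ) : ℕ → ℕ
  | 0 => 0
  | 1 => 0
  | L + 2 => b ^ (L + 1) + bestTail b L

theorem bestTail_lt (b : ℕ) (hb : 2 ≤ b) : ∀ L, bestTail b L < b ^ L
  | 0 => by simp [bestTail]
  | 1 => by simp [bestTail]; omega
  | L + 2 => by
    have h1 := bestTail_lt b hb L
    have h2 : b ^ L ≤ b ^ (L + 1) := Nat.pow_le_pow_right (by omega) (by omega)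
    have h3 : b ^ (L + 1) * 2 ≤ b ^ (L + 2) := by
      rw [pow_succ b (L + 1)]
      exact Nat.mul_le_mul_left _ hb
    rw [bestTail]
    omega

theorem sternB_bestTail (b : ℕ) (hb : 2 ≤ b) : ∀ L M,
    sternB b (b ^ L * M + bestTail b L + 1) =
      (L + 1).fib * sternB b (M + 1) + L.fib * sternB b M
  | 0, M => by simp [bestTail]
  | 1, M => by simp [bestTail, sternB_mul_add_one b M hb]
  | L + 2, M => by
    have h := sternB_bestTail b hb L (b * (b * M + 1))
    have e : b ^ (L + 2) * M + bestTail b (L + 2) + 1 =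
        b ^ L * (b * (b * M + 1)) + bestTail b L + 1 := by
      rw [bestTail]; ring
    rw [e, h, sternB_mul_add_one _ _ hb, sternB_mul _ _ hb, sternB_mul_add_one _ _ hb,
      sternB_mul_add _ _ 2 hb le_rfl hb, Nat.fib_add_two (n := L + 1), Nat.fib_add_two (n := L)]
    ring

/-- Appending a fixed block of `L` digits to `M` acts linearly on the pair
`(s_b(M + 1), s_b(M))`. The row `(α, β)` giving the first coordinate of the result has entries at
most `F_{L+1}` and entry sum at most `F_{L+2}`, and only the best tail of length `L` reaches
`(F_{L+1}, F_L)`. The last clause, the block reaching the mirrored row `(F_L, F_{L+1})`, is there to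
make the induction on `L` go through. -/
theorem exists_tail_coeff (b : ℕ) (hb : 2 ≤ b) : ∀ L m, m < b ^ L → ∃ α β : ℕ,
    (∀ M, sternB b (b ^ L * M + m + 1) = α * sternB b (M + 1) + β * sternB b M) ∧
    α ≤ (L + 1).fib ∧ β ≤ (L + 1).fib ∧ α + β ≤ (L + 2).fib ∧
    (α = (L + 1).fib → α + β = (L + 2).fib → m = bestTail b L) ∧
    (β = (L + 1).fib → α + β = (L + 2).fib → 1 ≤ L ∧ m = bestTail b (L - 1)) := by
  intro L
  induction L with
  | zero =>
    intro m hm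
    obtain rfl : m = 0 := by simpa using hm
    exact ⟨1, 0, by simp, by simp, by simp, by simp, by simp [bestTail], by simp⟩
  | succ L ih =>
    intro m hm
    have hpos : 0 < b ^ L := by positivity
    -- Split off the leading digit `d` of the block.
    obtain ⟨α, β, hs, hα, hβ, hαβ, hmax, hmir⟩ := ih (m % b ^ L) (Nat.mod_lt _ hpos)
    have hdiv := Nat.div_add_mod m (b ^ L)
    have hd : m / b ^ L < b := Nat.div_lt_of_lt_mul (by rwa [← pow_succ])
    set d := m / b ^ L with hd_def
    set m' := m % b ^ L with hm'_def
    have e : ∀ M, b ^ (L + 1) * M + m + 1 = b ^ L * (b * M + d) + m' + 1 := by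
      intro M
      rw [← hdiv]
      ring
    have f2 : (L + 2).fib = L.fib + (L + 1).fib := Nat.fib_add_two
    have f2' : (L + 1 + 1).fib = (L + 2).fib := rfl
    have f3 : (L + 1 + 2).fib = (L + 1).fib + (L + 2).fib := Nat.fib_add_two
    have fpos : 0 < (L + 1).fib := Nat.fib_pos.2 (by omega)
    -- `F_{L+2} = F_{L+1}` happens for `L = 0` only, where the row is `(1, 0)`.
    have fL : L.fib = 0 → L = 0 := Nat.fib_eq_zero.1
    have h0 : L = 0 → β = 0 := by
      rintro rfl
      by_contra hne
      have : β = 1 := by simp at hβ; omega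
      have h1 : α + β = 1 := by simp at hαβ; omega
      exact absurd (hmir (by simpa using this) (by simpa using h1)).1 (by omega)
    rcases Nat.lt_trichotomy d 1 with hd1 | hd1 | hd1
    · have hd0 : d = 0 := Nat.lt_one_iff.1 hd1
      rw [hd0, mul_zero, zero_add] at hdiv
      refine ⟨α, α + β, fun M => ?_, by omega, by omega, by omega, fun h1 h2 => ?_,
        fun h1 h2 => ?_⟩
      · rw [e, hs, hd0, add_zero, sternB_mul_add_one _ _ hb, sternB_mul _ _ hb]
        ring
      · obtain rfl : L = 0 := fL (by omega)
        have : m' = 0 := by rw [hm'_def, pow_zero, Nat.mod_one]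
        simp [bestTail, ← hdiv, this]
      · exact ⟨by omega, by rw [← hdiv, Nat.add_sub_cancel]; exact hmax (by omega) (by omega)⟩
    · rw [hd1, mul_one] at hdiv
      refine ⟨α + β, β, fun M => ?_, by omega, by omega, by omega, fun h1 h2 => ?_,
        fun h1 h2 => ?_⟩
      · rw [e, hs, hd1, sternB_mul_add_one _ _ hb, sternB_mul_add _ _ 2 hb le_rfl hb]
        ring
      · obtain ⟨hL, hm'⟩ := hmir (by omega) (by omega)
        obtain ⟨K, rfl⟩ : ∃ K, L = K + 1 := ⟨L - 1, by omega⟩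
        rw [← hdiv, hm', bestTail, Nat.add_sub_cancel]
      · have := h0 (fL (by omega))
        omega
    · refine ⟨α + β, 0, fun M => ?_, by omega, by omega, by omega, fun h1 h2 => ?_,
        fun h1 h2 => ?_⟩
      · rw [e, hs, add_assoc, sternB_mul_add _ _ (d + 1) hb (by omega) (by omega),
          sternB_mul_add _ _ d hb (by omega) (by omega)]
        ring
      · omega
      · omega

/-- Since the second coordinate is less than the first, the best tail maximizes `s_b` among all
tails of length `L`. -/
theorem sternB_tail_le (b : ℕ) (hb : 2 ≤ b) (L m M : ℕ) (hm : m < b ^ L)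
    (hM : sternB b M < sternB b (M + 1)) :
    sternB b (b ^ L * M + m + 1) ≤ (L + 1).fib * sternB b (M + 1) + L.fib * sternB b M := by
  obtain ⟨α, β, hs, hα, hβ, hαβ, -, -⟩ := exists_tail_coeff b hb L m hm
  obtain ⟨c, hc⟩ := Nat.exists_eq_add_of_le hM.le
  have f2 := Nat.fib_add_two (n := L)
  rw [hs, hc]
  nlinarith [Nat.mul_le_mul_right c hα, Nat.mul_le_mul_right (sternB b M) hαβ]

/-- The maximizing tail is unique: the weights `p - q` and `q` of `α` and `α + β` in
`α p + β q = α (p - q) + (α + β) q` are both positive, so equality forces both bounds to be attained. -/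
theorem eq_bestTail_of_sternB_eq (b : ℕ) (hb : 2 ≤ b) (L m M : ℕ) (hm : m < b ^ L)
    (hM : sternB b M < sternB b (M + 1)) (hpos : 0 < sternB b M)
    (h : sternB b (b ^ L * M + m + 1) = (L + 1).fib * sternB b (M + 1) + L.fib * sternB b M) :
    m = bestTail b L := by
  obtain ⟨α, β, hs, hα, hβ, hαβ, hmax, -⟩ := exists_tail_coeff b hb L m hm
  obtain ⟨c, hc⟩ := Nat.exists_eq_add_of_le hM.le
  have f2 := Nat.fib_add_two (n := L)
  rw [hs, hc] at h
  have h1 := Nat.mul_le_mul_right c hα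
  have h2 := Nat.mul_le_mul_right (sternB b M) hαβ
  have hsum : α * c + (α + β) * sternB b M = (L + 1).fib * c + (L + 2).fib * sternB b M := by
    rw [f2]
    linarith
  exact hmax (Nat.eq_of_mul_eq_mul_right (by omega : 0 < c) (by omega))
    (Nat.eq_of_mul_eq_mul_right hpos (by omega))

/-! ### Prefixes -/

/-- The value of the word `1 0^e (10)^x`. -/
def prefixVal (b e : ℕ) : ℕ → ℕ
  | 0 => b ^ e
  | x + 1 => b * (b * prefixVal b e x + 1)

theorem sternB_pow (b : ℕ) (hb : 2 ≤ b) : ∀ e, sternB b (b ^ e) = 1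
  | 0 => by rw [pow_zero]; rfl
  | e + 1 => by rw [pow_succ', sternB_mul _ _ hb, sternB_pow b hb e]

theorem sternB_pow_add_one (b : ℕ) (hb : 2 ≤ b) : ∀ e, sternB b (b ^ e + 1) = e + 1
  | 0 => by
    have h := sternB_mul_add b 0 2 hb le_rfl hb
    rw [mul_zero, zero_add, zero_add] at h
    exact h
  | e + 1 => by
    rw [pow_succ', sternB_mul_add_one _ _ hb, sternB_pow_add_one b hb e, sternB_pow b hb]

/-- The second value is `(e + 1) F_{2x} + F_{2x-1}`; it is stated with `F_{2x+1} - F_{2x}` in place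
of `F_{2x-1}`, which makes sense for `x = 0` too. -/
theorem sternB_prefixVal (b e : ℕ) (hb : 2 ≤ b) (x : ℕ) :
    sternB b (prefixVal b e x + 1) = (e + 1) * (2 * x + 1).fib + (2 * x).fib ∧
      sternB b (prefixVal b e x) + (2 * x).fib = (e + 1) * (2 * x).fib + (2 * x + 1).fib := by
  induction x with
  | zero => simp [prefixVal, sternB_pow b hb, sternB_pow_add_one b hb]
  | succ x ih =>
    obtain ⟨h1, h2⟩ := ih
    have f2 := Nat.fib_add_two (n := 2 * x)
    have f3 := Nat.fib_add_two (n := 2 * x + 1)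
    have e1 : 2 * (x + 1) = 2 * x + 2 := by ring
    rw [prefixVal, sternB_mul_add_one _ _ hb, sternB_mul _ _ hb, sternB_mul_add_one _ _ hb,
      sternB_mul_add _ _ 2 hb le_rfl hb, e1, f3, f2, h1]
    constructor <;> linarith

/-- The maximal value of `s_b` at `n` when `n - 1` is `1 0^{k-r-1} (10)^x 0` followed by a block of
`r - 2 x` arbitrary digits. -/
noncomputable def classMax (b k r x : ℕ) : ℕ :=
  (r - 2 * x + 1).fib * sternB b (b * prefixVal b (k - r - 1) x + 1) +
    (r - 2 * x).fib * sternB b (b * prefixVal b (k - r - 1) x)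

theorem sternB_mul_prefixVal_pos (b e : ℕ) (hb : 2 ≤ b) (x : ℕ) :
    0 < sternB b (b * prefixVal b e x) := by
  obtain ⟨-, h2⟩ := sternB_prefixVal b e hb x
  have h : 0 < (2 * x + 1).fib := Nat.fib_pos.2 (by omega)
  rw [sternB_mul _ _ hb]
  nlinarith [Nat.zero_le (e * (2 * x).fib)]

theorem sternB_mul_prefixVal_lt (b e : ℕ) (hb : 2 ≤ b) (x : ℕ) :
    sternB b (b * prefixVal b e x) < sternB b (b * prefixVal b e x + 1) := by
  obtain ⟨h1, -⟩ := sternB_prefixVal b e hb x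
  have h : 0 < (2 * x + 1).fib := Nat.fib_pos.2 (by omega)
  rw [sternB_mul_add_one _ _ hb, sternB_mul _ _ hb]
  nlinarith [Nat.zero_le (e * (2 * x + 1).fib)]

theorem pow_mul_prefixVal (b k r x : ℕ) (hx : 2 * x ≤ r) (hrk : r + 1 < k) :
    b ^ (r - 2 * x) * (b * prefixVal b (k - r - 1) x) =
      b ^ k + ∑ i ∈ Finset.range x, b ^ (r - 2 * i) := by
  induction x with
  | zero =>
    rw [Finset.sum_range_zero, prefixVal, add_zero, ← pow_succ', ← pow_add]
    congr 1
    omega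
  | succ x ih =>
    obtain ⟨j, rfl⟩ : ∃ j, r = 2 * x + 2 + j := ⟨r - (2 * x + 2), by omega⟩
    have h := ih (by omega)
    have e1 : 2 * x + 2 + j - 2 * x = j + 2 := by omega
    have e2 : 2 * x + 2 + j - 2 * (x + 1) = j := by omega
    rw [Finset.sum_range_succ, ← add_assoc, ← h, prefixVal, e1, e2]
    ring

/-! ### The number `γ(k, r, x)` -/

theorem ofDigits_reverse_append (b : ℕ) (u v : List ℕ) :
    Nat.ofDigits b (u ++ v).reverse =
      b ^ v.length * Nat.ofDigits b u.reverse + Nat.ofDigits b v.reverse := by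
  rw [List.reverse_append, Nat.ofDigits_append, List.length_reverse]
  ring

theorem ofDigits_prefix (b e x : ℕ) :
    Nat.ofDigits b ([1] ++ List.replicate e 0 ++ (List.replicate x [1, 0]).flatten).reverse =
      prefixVal b e x := by
  induction x with
  | zero => simp [prefixVal, Nat.ofDigits_append, Nat.ofDigits_replicate_zero]
  | succ x ih =>
    rw [List.replicate_succ', List.flatten_concat, ← List.append_assoc, ofDigits_reverse_append, ih,
      prefixVal]
    simp [Nat.ofDigits_cons]
    ring

theorem ofDigits_bestTail (b h ε : ℕ) (hε : ε ≤ 1) :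
    Nat.ofDigits b ((List.replicate h [1, 0]).flatten ++ List.replicate ε 0).reverse =
      bestTail b (2 * h + ε) := by
  induction h with
  | zero => interval_cases ε <;> simp [bestTail]
  | succ h ih =>
    have e1 : 2 * (h + 1) + ε = 2 * h + ε + 2 := by ring
    rw [List.replicate_succ, List.flatten_cons, List.append_assoc, ofDigits_reverse_append, ih, e1,
      bestTail]
    simp [Nat.ofDigits_cons]
    ring

theorem sternGamma_eq (b k r x : ℕ) (hx : 2 * x ≤ r) :
    sternGamma b k r x =
      b ^ (r - 2 * x) * (b * prefixVal b (k - r - 1) x) + bestTail b (r - 2 * x) := by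
  have hif : (if Odd r then [0] else []) = List.replicate (r % 2) 0 := by
    rcases Nat.even_or_odd r with h | h
    · rw [if_neg (Nat.not_odd_iff_even.2 h), Nat.even_iff.1 h, List.replicate_zero]
    · rw [if_pos h, Nat.odd_iff.1 h, List.replicate_one]
  have e1 : 2 * (r / 2 - x) + r % 2 = r - 2 * x := by omega
  have hlen : ((List.replicate (r / 2 - x) [1, 0]).flatten ++ List.replicate (r % 2) 0).length =
      r - 2 * x := by
    simp
    omega
  rw [sternGamma, gammaWord, hif, List.append_assoc _ _ (List.replicate (r % 2) 0),
    ofDigits_reverse_append, ofDigits_bestTail _ _ _ (by omega), hlen, ofDigits_reverse_append,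
    ofDigits_prefix, e1]
  simp

/-! ### The maximum over a union of classes -/

theorem sum_range_le_sum_range (b r : ℕ) {x y : ℕ} (h : x ≤ y) :
    ∑ i ∈ Finset.range x, b ^ (r - 2 * i) ≤ ∑ i ∈ Finset.range y, b ^ (r - 2 * i) :=
  Finset.sum_le_sum_of_subset (Finset.range_mono h)

theorem exists_class_of_mem_sternI (b k r y : ℕ) (hyr : 2 * y < r) (hrk : r + 1 < k) {n : ℕ}
    (hn : n ∈ sternI b k r y) : ∃ x ≤ y, ∃ m < b ^ (r - 2 * x),
      n = b ^ (r - 2 * x) * (b * prefixVal b (k - r - 1) x) + m + 1 := by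
  obtain ⟨hn1, hn2⟩ := hn
  induction y with
  | zero =>
    refine ⟨0, le_rfl, n - b ^ k - 1, ?_, ?_⟩
    · simp at hn2 ⊢
      omega
    · rw [pow_mul_prefixVal b k r 0 (by omega) hrk, Finset.sum_range_zero]
      omega
  | succ y ih =>
    by_cases h : n ≤ b ^ k + ∑ i ∈ Finset.range (y + 1), b ^ (r - 2 * i)
    · obtain ⟨x, hx, h⟩ := ih (by omega) h
      exact ⟨x, by omega, h⟩
    · rw [Finset.sum_range_succ] at hn2
      refine ⟨y + 1, le_rfl,
        n - (b ^ k + ∑ i ∈ Finset.range (y + 1), b ^ (r - 2 * i)) - 1, by omega, ?_⟩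
      rw [pow_mul_prefixVal b k r (y + 1) (by omega) hrk]
      omega

theorem mem_sternI_of_class (b k r y : ℕ) (hyr : 2 * y < r) (hrk : r + 1 < k) {x m : ℕ}
    (hx : x ≤ y) (hm : m < b ^ (r - 2 * x)) :
    b ^ (r - 2 * x) * (b * prefixVal b (k - r - 1) x) + m + 1 ∈ sternI b k r y := by
  have h := sum_range_le_sum_range b r (Nat.succ_le_succ hx)
  rw [Nat.succ_eq_add_one, Nat.succ_eq_add_one, Finset.sum_range_succ] at h
  rw [pow_mul_prefixVal b k r x (by omega) hrk]
  constructor <;> omega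

/-- The classes are consecutive intervals, increasing with the length of the prefix. -/
theorem class_lt_class (b k r : ℕ) (hrk : r + 1 < k) {x x' m m' : ℕ} (hx : x < x')
    (hx' : 2 * x' ≤ r) (hm : m < b ^ (r - 2 * x)) :
    b ^ (r - 2 * x) * (b * prefixVal b (k - r - 1) x) + m <
      b ^ (r - 2 * x') * (b * prefixVal b (k - r - 1) x') + m' := by
  have h := sum_range_le_sum_range b r (Nat.succ_le_of_lt hx)
  rw [Nat.succ_eq_add_one, Finset.sum_range_succ] at h
  rw [pow_mul_prefixVal b k r x (by omega) hrk, pow_mul_prefixVal b k r x' hx' hrk]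
  omega

theorem sternB_gamma (b k r x : ℕ) (hb : 2 ≤ b) (hx : 2 * x ≤ r) :
    sternB b (sternGamma b k r x + 1) = classMax b k r x := by
  rw [sternGamma_eq b k r x hx, sternB_bestTail b hb, classMax]

/-- If `x₀` is the first class on which the class maximum is largest, then `μ` is that maximum and
`ν` is attained at `γ(k, r, x₀) + 1`. -/
theorem sternNu_sternMu_of_classMax (b : ℕ) (hb : 2 ≤ b) (k r y x₀ : ℕ) (hyr : 2 * y < r)
    (hrk : r + 1 < k) (hx₀ : x₀ ≤ y) (hmax : ∀ x ≤ y, classMax b k r x ≤ classMax b k r x₀)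
    (hlt : ∀ x < x₀, classMax b k r x < classMax b k r x₀) :
    sternNu b k r y = sternGamma b k r x₀ + 1 ∧ sternMu b k r y = classMax b k r x₀ := by
  have hle : ∀ x m, m < b ^ (r - 2 * x) →
      sternB b (b ^ (r - 2 * x) * (b * prefixVal b (k - r - 1) x) + m + 1) ≤
        classMax b k r x := fun x m hm =>
    sternB_tail_le b hb _ m _ hm (sternB_mul_prefixVal_lt b _ hb x)
  have hmem : sternGamma b k r x₀ + 1 ∈ sternI b k r y := by
    rw [sternGamma_eq b k r x₀ (by omega)]
    exact mem_sternI_of_class b k r y hyr hrk hx₀ (bestTail_lt b hb _)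
  have hmu : sternMu b k r y = classMax b k r x₀ := by
    refine (sternMu_isGreatest b k r y hb).unique ⟨⟨_, hmem, sternB_gamma b k r x₀ hb (by omega)⟩, ?_⟩
    rintro _ ⟨n, hn, rfl⟩
    obtain ⟨x, hx, m, hm, rfl⟩ := exists_class_of_mem_sternI b k r y hyr hrk hn
    exact (hle x m hm).trans (hmax x hx)
  refine ⟨(sternNu_isLeast b k r y hb).unique ⟨⟨hmem, ?_⟩, ?_⟩, hmu⟩
  · rw [hmu, sternB_gamma b k r x₀ hb (by omega)]
  · rintro n ⟨hn, hs⟩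
    rw [hmu] at hs
    obtain ⟨x, hx, m, hm, rfl⟩ := exists_class_of_mem_sternI b k r y hyr hrk hn
    rw [sternGamma_eq b k r x₀ (by omega)]
    rcases Nat.lt_trichotomy x x₀ with h | rfl | h
    · exact absurd ((hle x m hm).trans_lt (hlt x h)) (by omega)
    · rw [eq_bestTail_of_sternB_eq b hb _ m _ hm (sternB_mul_prefixVal_lt b _ hb x)
        (sternB_mul_prefixVal_pos b _ hb x) hs]
    · exact Nat.succ_le_succ (class_lt_class b k r hrk h (by omega) (bestTail_lt b hb _)).le

/-! ### The class maximum in terms of Lucas numbers -/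

/-- The two parities of `n` in `5 F_m F_n = L_{m+n} - (-1)^n L_{m-n}`. -/
theorem five_mul_fib_mul_fib (m : ℤ) (n : ℕ) :
    5 * (Int.fib m * (2 * n).fib) = lucasZ (m + 2 * n) - lucasZ (m - 2 * n) ∧
      5 * (Int.fib m * (2 * n + 1).fib) = lucasZ (m + 2 * n + 1) + lucasZ (m - 2 * n - 1) := by
  have hL := lucasZ_spec.2.2
  induction n with
  | zero =>
    have h1 := Int.fib_add_two (n := m - 2)
    have h2 := Int.fib_add_two (n := m - 1)
    have h3 := Int.fib_add_two (n := m)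
    simp [lucasZ]
    ring_nf at h1 h2 h3 ⊢
    linarith
  | succ n ih =>
    obtain ⟨h1, h2⟩ := ih
    have f2 : (((2 * n + 2).fib : ℕ) : ℤ) = (2 * n).fib + (2 * n + 1).fib := by
      rw [Nat.fib_add_two]; push_cast; rfl
    have f3 : (((2 * n + 3).fib : ℕ) : ℤ) = (2 * n + 1).fib + (2 * n + 2).fib := by
      rw [Nat.fib_add_two]; push_cast; rfl
    have a1 := hL (m + 2 * n)
    have a2 := hL (m + 2 * n + 1)
    have a3 := hL (m - 2 * n - 2)
    have a4 := hL (m - 2 * n - 3)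
    have e1 : 2 * (n + 1) = 2 * n + 2 := by ring
    rw [e1, f2, show 2 * n + 2 + 1 = 2 * n + 3 from rfl, f3, f2]
    push_cast
    ring_nf at h1 h2 a1 a2 a3 a4 ⊢
    constructor <;> linarith

theorem classMax_eq_lucasV (b k r x : ℕ) (hb : 2 ≤ b) (hx : 2 * x ≤ r) (hrk : r + 1 < k) :
    (classMax b k r x : ℚ) = lucasV k r x := by
  obtain ⟨p1, p2⟩ := sternB_prefixVal b (k - r - 1) hb x
  obtain ⟨L, rfl⟩ : ∃ L, r = L + 2 * x := ⟨r - 2 * x, by omega⟩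
  obtain ⟨e, rfl⟩ : ∃ e, k = L + 2 * x + 1 + e := ⟨k - (L + 2 * x + 1), by omega⟩
  have e1 : L + 2 * x + 1 + e - (L + 2 * x) - 1 = e := by omega
  rw [e1] at p1 p2
  obtain ⟨i1, i2⟩ := five_mul_fib_mul_fib (L + 1) x
  obtain ⟨i3, i4⟩ := five_mul_fib_mul_fib L x
  rw [show ((L : ℤ) + 1) = ((L + 1 : ℕ) : ℤ) by push_cast; rfl, Int.fib_natCast] at i1 i2
  rw [Int.fib_natCast] at i3 i4
  have hL := lucasZ_spec.2.2
  have a1 := hL (L + 2 * x)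
  have a3 := hL (L - 2 * x - 1)
  have a4 := hL (L - 2 * x)
  have key : (5 * (classMax b (L + 2 * x + 1 + e) (L + 2 * x) x : ℤ)) =
      ((e : ℤ) + 1) * (2 * lucasZ (L + 2 * x + 2) - lucasZ (L - 2 * x + 1)) +
        2 * lucasZ (L + 2 * x + 1) + lucasZ (L - 2 * x + 2) := by
    rw [classMax, e1, Nat.add_sub_cancel, sternB_mul_add_one _ _ hb, sternB_mul _ _ hb]
    have p2' : (sternB b (prefixVal b e x) : ℤ) =
        (e + 1) * (2 * x).fib + (2 * x + 1).fib - (2 * x).fib := by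
      have := congrArg (Nat.cast : ℕ → ℤ) p2
      push_cast at this
      linarith
    push_cast [p1, p2']
    push_cast at i1 i2 i3 i4
    ring_nf at i1 i2 i3 i4 a1 a3 a4 ⊢
    linear_combination ((e : ℤ) + 1) * (i1 + i2 + i3 - a1) + i2 + i4 - i3 + a1 - a3 - a4
  have key' := congrArg (Int.cast : ℤ → ℚ) key
  push_cast at key'
  have t1 : (L : ℤ) + 2 * x - 4 * x + 1 = L - 2 * x + 1 := by ring
  have t2 : (L : ℤ) + 2 * x - 4 * x + 2 = L - 2 * x + 2 := by ring
  rw [lucasV]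
  push_cast
  rw [t1, t2]
  linarith

/-- Passing from `x` to `x + 1` changes `V(k, r, x)` by `(k - r) F_{t-1} - F_t`, `t = r - 4 x`. -/
theorem lucasV_succ (k r x : ℤ) :
    lucasV k r (x + 1) - lucasV k r x =
      (k - r) * Int.fib (r - 4 * x - 1) - Int.fib (r - 4 * x) := by
  set t := r - 4 * x with ht
  have key : ((k - r) * (-lucasZ (t - 3)) + lucasZ (t - 2)) -
      ((k - r) * (-lucasZ (t + 1)) + lucasZ (t + 2)) =
      5 * ((k - r) * Int.fib (t - 1) - Int.fib t) := by
    have a1 := Int.fib_add_two (n := t - 4)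
    have a2 := Int.fib_add_two (n := t - 3)
    have a3 := Int.fib_add_two (n := t - 2)
    have a4 := Int.fib_add_two (n := t - 1)
    have a5 := Int.fib_add_two (n := t)
    have a6 := Int.fib_add_two (n := t + 1)
    have d1 : lucasZ (t + 1) - lucasZ (t - 3) = 5 * Int.fib (t - 1) := by
      simp only [lucasZ]
      ring_nf at a1 a2 a3 a4 a5 a6 ⊢
      linarith
    have d2 : lucasZ (t + 2) - lucasZ (t - 2) = 5 * Int.fib t := by
      simp only [lucasZ]
      ring_nf at a1 a2 a3 a4 a5 a6 ⊢
      linarith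
    linear_combination (k - r) * d1 - d2
  have key' := congrArg (Int.cast : ℤ → ℚ) key
  push_cast at key'
  have e1 : r - 4 * (x + 1) + 1 = t - 3 := by rw [ht]; ring
  have e2 : r - 4 * (x + 1) + 2 = t - 2 := by rw [ht]; ring
  rw [lucasV, lucasV, e1, e2, ← ht]
  linarith

/-! ### Comparing consecutive class maxima -/

theorem fib_pos_of_odd {n : ℤ} (hn : Odd n) : 0 < Int.fib n := by
  obtain ⟨j, rfl⟩ := hn
  exact Int.fib_two_mul_add_one_pos

theorem fib_nonpos_of_even {n : ℤ} (hn : Even n) (h0 : n ≤ 0) : Int.fib n ≤ 0 := by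
  obtain ⟨j, rfl⟩ : ∃ j : ℕ, n = -j := ⟨n.natAbs, by omega⟩
  rw [Int.fib_neg, if_pos (by simpa using hn), Int.fib_natCast]
  simp

theorem mul_fib_pred_sub_fib (E t : ℤ) :
    E * Int.fib (t - 1) - Int.fib t = (E - 2) * Int.fib (t - 1) + Int.fib (t - 3) := by
  have a1 := Int.fib_add_two (n := t - 3)
  have a2 := Int.fib_add_two (n := t - 2)
  ring_nf at a1 a2 ⊢
  linarith

theorem lucasV_lt_succ_of_even {k r x : ℤ} (hkr : r + 2 ≤ k) (hr : Even r) :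
    lucasV k r x < lucasV k r (x + 1) := by
  have h : 0 < (k - r) * Int.fib (r - 4 * x - 1) - Int.fib (r - 4 * x) := by
    rw [mul_fib_pred_sub_fib]
    have h1 : 0 < Int.fib (r - 4 * x - 1) := fib_pos_of_odd (by grind)
    have h3 : 0 < Int.fib (r - 4 * x - 3) := fib_pos_of_odd (by grind)
    have := mul_nonneg (by omega : 0 ≤ k - r - 2) h1.le
    omega
  have h' : (0 : ℚ) < ((k - r) * Int.fib (r - 4 * x - 1) - Int.fib (r - 4 * x) : ℤ) := by
    exact_mod_cast h
  push_cast at h'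
  linarith [lucasV_succ k r x]

theorem lucasV_lt_succ_of_odd {k r x : ℤ} (hkr : r + 2 ≤ k) (ht : 3 ≤ r - 4 * x)
    (h : 5 ≤ r - 4 * x ∨ r + 3 ≤ k) : lucasV k r x < lucasV k r (x + 1) := by
  have h : 0 < (k - r) * Int.fib (r - 4 * x - 1) - Int.fib (r - 4 * x) := by
    rw [mul_fib_pred_sub_fib]
    have h1 : 0 < Int.fib (r - 4 * x - 1) := by
      rw [Int.fib_of_nonneg (by omega)]
      exact_mod_cast Nat.fib_pos.2 (by omega)
    have h3 : 0 ≤ Int.fib (r - 4 * x - 3) := by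
      rw [Int.fib_of_nonneg (by omega)]
      exact Int.natCast_nonneg _
    rcases h with h | h
    · have h3 : 0 < Int.fib (r - 4 * x - 3) := by
        rw [Int.fib_of_nonneg (by omega)]
        exact_mod_cast Nat.fib_pos.2 (by omega)
      have := mul_nonneg (by omega : 0 ≤ k - r - 2) h1.le
      omega
    · have := mul_pos (by omega : 0 < k - r - 2) h1
      omega
  have h' : (0 : ℚ) < ((k - r) * Int.fib (r - 4 * x - 1) - Int.fib (r - 4 * x) : ℤ) := by
    exact_mod_cast h
  push_cast at h'
  linarith [lucasV_succ k r x]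

/-- The only tie between consecutive classes: here the change is `2 F_2 - F_3 = 0`. -/
theorem lucasV_succ_eq_of_tie {k r x : ℤ} (hkr : k = r + 2) (ht : r - 4 * x = 3) :
    lucasV k r (x + 1) = lucasV k r x := by
  have h : (k - r) * Int.fib (r - 4 * x - 1) - Int.fib (r - 4 * x) = 0 := by
    rw [mul_fib_pred_sub_fib, ht, hkr]
    simp
  have h' : (((k - r) * Int.fib (r - 4 * x - 1) - Int.fib (r - 4 * x) : ℤ) : ℚ) = 0 := by
    exact_mod_cast h
  push_cast at h'
  linarith [lucasV_succ k r x]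

theorem lucasV_succ_lt_of_odd {k r x : ℤ} (hkr : r ≤ k) (hr : Odd r) (ht : r - 4 * x ≤ 1) :
    lucasV k r (x + 1) < lucasV k r x := by
  have h : (k - r) * Int.fib (r - 4 * x - 1) - Int.fib (r - 4 * x) < 0 := by
    have h1 : Int.fib (r - 4 * x - 1) ≤ 0 := fib_nonpos_of_even (by grind) (by omega)
    have h2 : 0 < Int.fib (r - 4 * x) := fib_pos_of_odd (by grind)
    have := mul_nonpos_of_nonneg_of_nonpos (by omega : 0 ≤ k - r) h1
    omega
  have h' : (((k - r) * Int.fib (r - 4 * x - 1) - Int.fib (r - 4 * x) : ℤ) : ℚ) < 0 := by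
    exact_mod_cast h
  push_cast at h'
  linarith [lucasV_succ k r x]

/-- `V(k, r, ·)` is unimodal: once it increases strictly up to `x₀` and does not increase from
`x₀` to `y`, its first maximum on `{0, …, y}` is at `x₀`, which determines `ν` and `μ`. -/
theorem sternNu_sternMu_of_unimodal (b : ℕ) (hb : 2 ≤ b) (k r y x₀ : ℕ) (hyr : 2 * y < r)
    (hrk : r + 1 < k) (hx₀ : x₀ ≤ y)
    (hup : ∀ x : ℕ, x < x₀ → lucasV k r x < lucasV k r (x + 1))
    (hdown : ∀ x : ℕ, x₀ ≤ x → x < y → lucasV k r (x + 1) ≤ lucasV k r x) :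
    sternNu b k r y = sternGamma b k r x₀ + 1 ∧ (sternMu b k r y : ℚ) = lucasV k r x₀ := by
  have hmono : ∀ n : ℕ, n ≤ x₀ → ∀ x : ℕ, x < n → lucasV k r x < lucasV k r n := by
    intro n
    induction n with
    | zero => intro _ x hx; omega
    | succ n ih =>
      intro hn x hx
      have h1 := hup n (by omega)
      push_cast
      rcases Nat.lt_succ_iff_lt_or_eq.1 hx with h | rfl
      · exact (ih (by omega) x h).trans h1
      · exact h1
  have hanti : ∀ d : ℕ, x₀ + d ≤ y → lucasV k r (x₀ + d : ℕ) ≤ lucasV k r x₀ := by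
    intro d
    induction d with
    | zero => simp
    | succ d ih =>
      intro hd
      refine le_trans ?_ (ih (by omega))
      exact_mod_cast hdown (x₀ + d) (by omega) (by omega)
  have hcast : ∀ x ≤ y, (classMax b k r x : ℚ) = lucasV k r x := fun x hx =>
    classMax_eq_lucasV b k r x hb (by omega) hrk
  have hlt : ∀ x < x₀, classMax b k r x < classMax b k r x₀ := by
    intro x hx
    have h := hmono x₀ le_rfl x hx
    rw [← hcast x (by omega), ← hcast x₀ hx₀] at h
    exact_mod_cast h
  have hmax : ∀ x ≤ y, classMax b k r x ≤ classMax b k r x₀ := by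
    intro x hx
    rcases lt_or_ge x x₀ with h | h
    · exact (hlt x h).le
    · obtain ⟨d, rfl⟩ := Nat.exists_eq_add_of_le h
      have h' := hanti d hx
      rw [← hcast _ hx, ← hcast x₀ hx₀] at h'
      exact_mod_cast h'
  obtain ⟨h1, h2⟩ := sternNu_sternMu_of_classMax b hb k r y x₀ hyr hrk hx₀ hmax hlt
  exact ⟨h1, by rw [h2, hcast x₀ hx₀]⟩

/-! ### The choice of the class -/

theorem ceil_sub_one_div_four_le_iff (r n : ℕ) : ⌈((r : ℚ) - 1) / 4⌉₊ ≤ n ↔ r ≤ 4 * n + 1 := by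
  rw [Nat.ceil_le, div_le_iff₀ (by norm_num), sub_le_iff_le_add]
  norm_cast
  rw [mul_comm]

theorem mainTheorem3 (b : ℕ) (hb : 2 ≤ b) (k r y : ℕ) (hyr : 2 * y < r) (hrk : r + 1 < k) :
    (Even r →
      sternNu b k r y = sternGamma b k r y + 1 ∧
        (sternMu b k r y : ℚ) = lucasV k r y) ∧
    (k = r + 2 → r ≡ 3 [MOD 4] → r + 1 ≤ 4 * y →
      sternNu b k r y = sternGamma b k r ((r - 3) / 4) + 1 ∧
        (sternMu b k r y : ℚ) = lucasV k r ((r - 3) / 4 : ℕ)) ∧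
    (¬ Even r → ¬ (k = r + 2 ∧ r ≡ 3 [MOD 4] ∧ r + 1 ≤ 4 * y) →
      sternNu b k r y = sternGamma b k r (sternDelta r y) + 1 ∧
        (sternMu b k r y : ℚ) = lucasV k r (sternDelta r y)) := by
  refine ⟨fun hr => ?_, fun hk hr4 hy => ?_, fun hr hn => ?_⟩
  · refine sternNu_sternMu_of_unimodal b hb k r y y hyr hrk le_rfl (fun x _ => ?_)
      (fun x h1 h2 => by omega)
    exact lucasV_lt_succ_of_even (by omega) (by exact_mod_cast hr)
  · have hr3 : r % 4 = 3 := hr4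
    refine sternNu_sternMu_of_unimodal b hb k r y ((r - 3) / 4) hyr hrk (by omega)
      (fun x hx => ?_) (fun x h1 h2 => ?_)
    · exact lucasV_lt_succ_of_odd (by omega) (by omega) (Or.inl (by omega))
    · rcases h1.eq_or_lt with h | h
      · exact (lucasV_succ_eq_of_tie (by omega) (by omega)).le
      · exact (lucasV_succ_lt_of_odd (by omega) (by grind) (by omega)).le
  · have hr' : r % 2 = 1 := Nat.odd_iff.1 (Nat.not_even_iff_odd.1 hr)
    refine sternNu_sternMu_of_unimodal b hb k r y (sternDelta r y) hyr hrk (min_le_right _ _)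
      (fun x hx => ?_) (fun x h1 h2 => ?_)
    · obtain ⟨hx1, hx2⟩ := lt_min_iff.1 hx
      have hx3 : ¬ r ≤ 4 * x + 1 := fun h =>
        absurd ((ceil_sub_one_div_four_le_iff r x).2 h) (not_le.2 hx1)
      have hmod : r ≡ 3 [MOD 4] ↔ r % 4 = 3 := Iff.rfl
      rw [hmod] at hn
      -- A tie between `x` and `x + 1` needs `r - 4 x = 3` and `k = r + 2`, the excluded case.
      exact lucasV_lt_succ_of_odd (by omega) (by omega) (by omega)
    · have h3 : ⌈((r : ℚ) - 1) / 4⌉₊ ≤ x := (min_le_iff.1 h1).resolve_right (by omega)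
      rw [ceil_sub_one_div_four_le_iff] at h3
      exact (lucasV_succ_lt_of_odd (by omega) (by grind) (by omega)).le
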